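/- Let $(\Omega,\mathcal F,\mathbb P)$ be a probability space, $\mathbf Y:\Omega\to\mathbb R^K$ a random vector, and $D\subset\mathbb R^d$ a bounded open set. Let $V\otimes S=H^1_0(D)\otimes L^2_{\mathbb P}(\Omega)=L^2(\Omega,\mathbb P;H^1_0(D))$, the space of random fields $v$ on $D\times\Omega$ with $v(\cdot,\omega)\in H^1_0(D)$ and $\mathbb E\{\|v\|^2_{H^1_0(D)}\}<\infty$, where $H^1_0(D)$ is the closure of $C_c^\infty(D)$ in $H^1(D)$. Let $\kappa(x,y)$, $f(x,u,y)$ and $F(x,u,y)$ be real-valued measurable functions of $x\in\bar D$, $u\in\mathbb R$, $y\in\mathbb R^K$. Assume that there are constants $0<\kappa_{\min}\le\kappa_{\max}$, $f_{\max}$, $L_f$, $\delta>0$ and $F_{\min}$ such that, for $\mathbb P$-almost every $\omega$, for all $x\in\bar D$ and all $u,u_1,u_2\in\mathbb R$: 1. $\kappa_{\min}\le\kappa(x,\mathbf Y(\omega))\le\kappa_{\max}$; 2. $|f(x,0,\mathbf Y(\omega))|\le f_{\max}$; 3. $|f(x,u_1,\mathbf Y(\omega))-f(x,u_2,\mathbf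 Y(\omega))|\le L_f|u_1-u_2|$; 4. $f(x,\cdot,\mathbf Y(\omega))$ is differentiable and $\partial_u f(x,u,\mathbf Y(\omega))\ge\delta$; 5. $\partial_u F(x,u,\mathbf Y(\omega))=f(x,u,\mathbf Y(\omega))$ and $F(x,u,\mathbf Y(\omega))\ge F_{\min}$. Assume moreover that $(x,\omega)\mapsto F(x,0,\mathbf Y(\omega))$ is integrable on $D\times\Omega$. Then the energy $$E(u)=\mathbb E\Big\{\int_D \tfrac12\kappa(x,\mathbf Y)|\nabla_x u|^2+F(x,u,\mathbf Y)\,dx\Big\}$$ is well defined and finite for every $u\in V\otimes S$, and it has a minimizer $u^*\in V\otimes S$. Furthermore, every minimizer $u^*$ satisfies $$\mathbb E\Big\{\int_D \kappa(x,\mathbf Y)\nabla_x u^*\cdot\nabla_x v+f(x,u^*,\mathbf Y)\,v\,dx\Big\}=0\qquad\text{for all } v\in V\otimes S,$$ the integrand being integrable. -/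

import Mathlib

open MeasureTheory

noncomputable section

namespace StochElliptic

/-- The ambient Hilbert space `L²(D) × L²(D; ℝᵈ)` with norm
`‖(u, g)‖² = ‖u‖²_{L²(D)} + ‖g‖²_{L²(D)}`; the pair `(u, ∇u)` has the `H¹(D)` norm of `u` there. -/
abbrev L2Pair {d : ℕ} (D : Set (EuclideanSpace ℝ (Fin d))) : Type :=
  WithLp 2 (Lp ℝ 2 (volume.restrict D) × Lp (EuclideanSpace ℝ (Fin d)) 2 (volume.restrict D))

/-- `p` is the pair `(φ, ∇φ)` of a test function `φ ∈ C_c^∞(D)` (equality almost everywhere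
on `D`). -/
def IsTestPair {d : ℕ} (D : Set (EuclideanSpace ℝ (Fin d))) (p : L2Pair D) : Prop :=
  ∃ φ : EuclideanSpace ℝ (Fin d) → ℝ,
    ContDiff ℝ ((⊤ : ℕ∞) : WithTop ℕ∞) φ ∧ HasCompactSupport φ ∧ tsupport φ ⊆ D ∧
      p.fst =ᵐ[volume.restrict D] φ ∧ p.snd =ᵐ[volume.restrict D] gradient φ

/-- The Sobolev space `H¹₀(D)`: the closure of `C_c^∞(D)` in the `H¹(D)` norm. An element is stored
as the pair `(u, ∇u)` of a function and its weak gradient. (The test pairs already form a linear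
subspace, so taking their span adds nothing.) -/
def H10 {d : ℕ} (D : Set (EuclideanSpace ℝ (Fin d))) : Submodule ℝ (L2Pair D) :=
  (Submodule.span ℝ {p | IsTestPair D p}).topologicalClosure

variable {d : ℕ} {D : Set (EuclideanSpace ℝ (Fin d))}

/-- The function underlying an element of `H¹₀(D)`. -/
def H10.toFun (w : H10 D) : EuclideanSpace ℝ (Fin d) → ℝ :=
  fun x => w.val.fst x

/-- The weak gradient of an element of `H¹₀(D)`. -/
def H10.grad (w : H10 D) : EuclideanSpace ℝ (Fin d) → EuclideanSpace ℝ (Fin d) :=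
  fun x => w.val.snd x

/-- The Hilbert tensor product `H¹₀(D) ⊗ L²_P(Ω) = L²(Ω, P; H¹₀(D))`: the random fields `v` on
`D × Ω` with `v(·, ω) ∈ H¹₀(D)` and `𝔼 ‖v‖²_{H¹₀(D)} < ∞`, up to almost sure equality. -/
abbrev VS {d : ℕ} (D : Set (EuclideanSpace ℝ (Fin d)))
    {Ω : Type*} [MeasurableSpace Ω] (P : Measure Ω) : Type _ :=
  Lp (H10 D) 2 P

/-- `𝔼 {∫_D g(x, ω) dx}` is well defined and finite. -/
def ExpIntegrable {Ω : Type*} [MeasurableSpace Ω]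
    (D : Set (EuclideanSpace ℝ (Fin d))) (P : Measure Ω)
    (g : Ω → EuclideanSpace ℝ (Fin d) → ℝ) : Prop :=
  (∀ᵐ ω ∂P, IntegrableOn (g ω) D volume) ∧ Integrable (fun ω => ∫ x in D, g ω x) P

/-- `𝔼 {∫_D g(x, ω) dx}`. -/
def expIntegral {Ω : Type*} [MeasurableSpace Ω]
    (D : Set (EuclideanSpace ℝ (Fin d))) (P : Measure Ω)
    (g : Ω → EuclideanSpace ℝ (Fin d) → ℝ) : ℝ :=
  ∫ ω, (∫ x in D, g ω x) ∂P

/-- The energy density `½ κ(x, Y) |∇ₓu|² + F(x, u, Y)`. -/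
def energyDensity {K : ℕ} {Ω : Type*} [MeasurableSpace Ω] {P : Measure Ω}
    (κ : EuclideanSpace ℝ (Fin d) → (Fin K → ℝ) → ℝ)
    (F : EuclideanSpace ℝ (Fin d) → ℝ → (Fin K → ℝ) → ℝ)
    (Y : Ω → Fin K → ℝ) (u : VS D P) (ω : Ω) (x : EuclideanSpace ℝ (Fin d)) : ℝ :=
  1 / 2 * κ x (Y ω) * ‖H10.grad (u ω) x‖ ^ 2 + F x (H10.toFun (u ω) x) (Y ω)

/-- The energy `E(u) = 𝔼 {∫_D ½ κ(x, Y) |∇ₓu|² + F(x, u, Y) dx}`. -/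
def energy {K : ℕ} {Ω : Type*} [MeasurableSpace Ω] {P : Measure Ω}
    (κ : EuclideanSpace ℝ (Fin d) → (Fin K → ℝ) → ℝ)
    (F : EuclideanSpace ℝ (Fin d) → ℝ → (Fin K → ℝ) → ℝ)
    (Y : Ω → Fin K → ℝ) (u : VS D P) : ℝ :=
  expIntegral D P (energyDensity κ F Y u)

/-- The integrand `κ(x, Y) ∇ₓu · ∇ₓv + f(x, u, Y) v` of the weak form. -/
def weakDensity {K : ℕ} {Ω : Type*} [MeasurableSpace Ω] {P : Measure Ω}
    (κ : EuclideanSpace ℝ (Fin d) → (Fin K → ℝ) → ℝ)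
    (f : EuclideanSpace ℝ (Fin d) → ℝ → (Fin K → ℝ) → ℝ)
    (Y : Ω → Fin K → ℝ) (u v : VS D P) (ω : Ω) (x : EuclideanSpace ℝ (Fin d)) : ℝ :=
  κ x (Y ω) * inner ℝ (H10.grad (u ω) x) (H10.grad (v ω) x)
    + f x (H10.toFun (u ω) x) (Y ω) * H10.toFun (v ω) x

end StochElliptic

end

/-! The energy is strongly convex in the full `H¹` norm: κ ≥ κmin controls the gradient and ∂ᵤf ≥ δ
controls the function itself, so no Poincaré inequality is needed. Dually, κ ≤ κmax and the
Lipschitz bound on f give a quadratic upper bound. Hence E differs from its first order expansion by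
an amount between m/2 ‖v‖² and M/2 ‖v‖², with m = min κmin δ and M = max κmax Lf. `QuadPinched`
records this.

These bounds suffice on a complete space. Completing the square bounds E below, the midpoint
inequality makes minimizing sequences Cauchy, and continuity of E passes to the limit
(`exists_minimizer`). The derivative at a minimizer is nonnegative in every direction, hence zero.

The bounds hold on ℝ for F (`taylor_bounds`), integrate over D for almost every ω
(`Admissible.quadPinched`), and, since the constants do not depend on ω, integrate over Ω
(`QuadPinched.superposition`). -/

namespace StochElliptic

open Filter Topology

/-- A functional `E` with directional derivatives `E' u v` along which it differs from its first
order expansion by an amount between `m / 2 * ‖v‖ ^ 2` and `M / 2 * ‖v‖ ^ 2`. -/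
structure QuadPinched {H : Type*} [NormedAddCommGroup H] [NormedSpace ℝ H]
    (E : H → ℝ) (E' : H → H → ℝ) (m M C : ℝ) : Prop where
  smul : ∀ u v (t : ℝ), E' u (t • v) = t * E' u v
  lower : ∀ u v, E u + E' u v + m / 2 * ‖v‖ ^ 2 ≤ E (u + v)
  upper : ∀ u v, E (u + v) ≤ E u + E' u v + M / 2 * ‖v‖ ^ 2
  bound : ∀ u v, |E' u v| ≤ C * (1 + ‖u‖ ^ 2 + ‖v‖ ^ 2)

/-! ### Minimization of strongly convex functionals -/

namespace QuadPinched

variable {H : Type*} [NormedAddCommGroup H] [NormedSpace ℝ H]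
  {E : H → ℝ} {E' : H → H → ℝ} {m M C : ℝ}

/-- Homogeneity applied to the unit vector v/‖v‖ turns the quadratic bound into one linear in ‖v‖.
-/
lemma abs_deriv_le (h : QuadPinched E E' m M C) (u v : H) :
    |E' u v| ≤ C * (2 + ‖u‖ ^ 2) * ‖v‖ := by
  rcases eq_or_ne v 0 with rfl | hv
  · have := h.smul u 0 0
    simp only [smul_zero, zero_mul] at this
    simp [this]
  · have hn : 0 < ‖v‖ := norm_pos_iff.2 hv
    have hb := h.bound u (‖v‖⁻¹ • v)
    rw [h.smul, norm_smul, abs_mul, abs_of_pos (inv_pos.2 hn), norm_inv, norm_norm,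
      inv_mul_cancel₀ hn.ne'] at hb
    have hb' := mul_le_mul_of_nonneg_left hb hn.le
    rw [mul_inv_cancel_left₀ hn.ne'] at hb'
    linarith

lemma abs_sub_le (h : QuadPinched E E' m M C) (hm : 0 ≤ m) (u v : H) :
    |E (u + v) - E u| ≤ |E' u v| + |M| / 2 * ‖v‖ ^ 2 := by
  have hl := h.lower u v
  have hu := h.upper u v
  have h1 : 0 ≤ m / 2 * ‖v‖ ^ 2 := by positivity
  have h2 : M / 2 * ‖v‖ ^ 2 ≤ |M| / 2 * ‖v‖ ^ 2 := by
    gcongr; exact le_abs_self M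
  have h3 : 0 ≤ |M| / 2 * ‖v‖ ^ 2 := by positivity
  rw [abs_le]
  constructor <;> linarith [neg_abs_le (E' u v), le_abs_self (E' u v)]

lemma continuous (h : QuadPinched E E' m M C) (hm : 0 ≤ m) : Continuous E := by
  rw [continuous_iff_continuousAt]
  intro u
  have hz : Tendsto (fun w : H => C * (2 + ‖u‖ ^ 2) * ‖w - u‖ + |M| / 2 * ‖w - u‖ ^ 2) (𝓝 u)
      (𝓝 0) := by
    have : Continuous fun w : H =>
        C * (2 + ‖u‖ ^ 2) * ‖w - u‖ + |M| / 2 * ‖w - u‖ ^ 2 := by fun_prop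
    simpa using this.tendsto u
  rw [ContinuousAt, tendsto_iff_norm_sub_tendsto_zero]
  refine squeeze_zero (fun _ => norm_nonneg _) (fun w => ?_) hz
  have h1 := h.abs_sub_le hm u (w - u)
  have h2 := h.abs_deriv_le u (w - u)
  rw [add_sub_cancel] at h1
  rw [Real.norm_eq_abs]
  linarith

/-- Used twice: for the sign of the derivative at a minimizer, and for the measurability of random
derivatives. -/
lemma tendsto_quotient (h : QuadPinched E E' m M C) (u v : H) :
    Tendsto (fun n : ℕ => ((n : ℝ) + 1) * (E (u + ((n : ℝ) + 1)⁻¹ • v) - E u)) atTop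
      (𝓝 (E' u v)) := by
  have key : ∀ c : ℝ, Tendsto (fun n : ℕ => E' u v + c * ‖v‖ ^ 2 * (1 / ((n : ℝ) + 1))) atTop
      (𝓝 (E' u v)) := fun c => by
    simpa using (tendsto_one_div_add_atTop_nhds_zero_nat.const_mul (c * ‖v‖ ^ 2)).const_add
      (E' u v)
  have hexp : ∀ (c : ℝ) (n : ℕ), E' u v + c * ‖v‖ ^ 2 * (1 / ((n : ℝ) + 1)) =
      ((n : ℝ) + 1) * (E' u (((n : ℝ) + 1)⁻¹ • v) + c * ‖((n : ℝ) + 1)⁻¹ • v‖ ^ 2) := by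
    intro c n
    have hn : (0 : ℝ) < (n : ℝ) + 1 := by positivity
    rw [h.smul, norm_smul, norm_inv, Real.norm_of_nonneg hn.le]
    field_simp
  refine tendsto_of_tendsto_of_tendsto_of_le_of_le (key (m / 2)) (key (M / 2)) ?_ ?_
  · intro n
    simp only [hexp]
    have := h.lower u (((n : ℝ) + 1)⁻¹ • v)
    gcongr
    linarith
  · intro n
    simp only [hexp]
    have := h.upper u (((n : ℝ) + 1)⁻¹ • v)
    gcongr
    linarith

lemma bddBelow (h : QuadPinched E E' m M C) (hm : 0 < m) : BddBelow (Set.range E) := by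
  -- The subtracted term is minus the minimum over r of m/2 r² - 2C r.
  refine ⟨E 0 - (C * 2) ^ 2 / (2 * m), ?_⟩
  rintro _ ⟨v, rfl⟩
  have h1 := h.lower 0 v
  have h2 := h.abs_deriv_le 0 v
  simp only [norm_zero, zero_add] at h1 h2
  have h3 : 0 ≤ m / 2 * (‖v‖ - C * 2 / m) ^ 2 := by positivity
  have h4 : m / 2 * (‖v‖ - C * 2 / m) ^ 2 =
      m / 2 * ‖v‖ ^ 2 - C * 2 * ‖v‖ + (C * 2) ^ 2 / (2 * m) := by
    field_simp; ring
  have h5 : C * (2 + 0 ^ 2) * ‖v‖ = C * 2 * ‖v‖ := by ring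
  linarith [neg_abs_le (E' 0 v)]

/-- Add the lower bounds at the midpoint in the directions ±(u - w)/2: the first order terms cancel.
-/
lemma midpoint_le (h : QuadPinched E E' m M C) (u w : H) :
    2 * E ((1 / 2 : ℝ) • (u + w)) + m / 4 * ‖u - w‖ ^ 2 ≤ E u + E w := by
  have h1 := h.lower ((1 / 2 : ℝ) • (u + w)) ((1 / 2 : ℝ) • (u - w))
  have h2 := h.lower ((1 / 2 : ℝ) • (u + w)) ((-(1 / 2) : ℝ) • (u - w))
  rw [h.smul, norm_smul, show (1 / 2 : ℝ) • (u + w) + (1 / 2 : ℝ) • (u - w) = u by module] at h1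
  rw [h.smul, norm_smul, show (1 / 2 : ℝ) • (u + w) + (-(1 / 2) : ℝ) • (u - w) = w by module]
    at h2
  rw [Real.norm_of_nonneg (by norm_num : (0 : ℝ) ≤ 1 / 2)] at h1
  rw [norm_neg, Real.norm_of_nonneg (by norm_num : (0 : ℝ) ≤ 1 / 2)] at h2
  linarith

/-- A strongly convex functional of this kind attains its infimum: minimizing sequences are
Cauchy. -/
theorem exists_minimizer [CompleteSpace H] (h : QuadPinched E E' m M C) (hm : 0 < m) :
    ∃ u, ∀ w, E u ≤ E w := by
  have hb := h.bddBelow hm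
  set I := sInf (Set.range E) with hI
  have hle : ∀ w, I ≤ E w := fun w => csInf_le hb ⟨w, rfl⟩
  -- The excess m/8 · (n+1)⁻² is chosen so that two terms beyond N give exactly ‖u n - u k‖ ≤
  -- 1/(N+1) in the midpoint inequality.
  have hex : ∀ n : ℕ, ∃ u, E u < I + m / 8 * (1 / ((n : ℝ) + 1)) ^ 2 := by
    intro n
    obtain ⟨_, ⟨u, rfl⟩, hu⟩ := exists_lt_of_csInf_lt (Set.range_nonempty E)
      (show sInf (Set.range E) < I + m / 8 * (1 / ((n : ℝ) + 1)) ^ 2 by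
        rw [← hI]; exact lt_add_of_pos_right _ (by positivity))
    exact ⟨u, hu⟩
  choose u hu using hex
  have hcauchy : CauchySeq u := by
    refine cauchySeq_of_le_tendsto_0 (fun n : ℕ => 1 / ((n : ℝ) + 1)) ?_
      tendsto_one_div_add_atTop_nhds_zero_nat
    intro n k N hn hk
    have hsq : ∀ j : ℕ, N ≤ j → E (u j) ≤ I + m / 8 * (1 / ((N : ℝ) + 1)) ^ 2 := by
      intro j hj
      refine (hu j).le.trans ?_
      gcongr
    have h1 := h.midpoint_le (u n) (u k)
    have h2 := hle ((1 / 2 : ℝ) • (u n + u k))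
    have h3 : m / 4 * ‖u n - u k‖ ^ 2 ≤ m / 4 * (1 / ((N : ℝ) + 1)) ^ 2 := by
      linarith [hsq n hn, hsq k hk]
    have h4 : ‖u n - u k‖ ^ 2 ≤ (1 / ((N : ℝ) + 1)) ^ 2 := le_of_mul_le_mul_left h3 (by positivity)
    rw [dist_eq_norm]
    exact le_of_sq_le_sq h4 (by positivity)
  obtain ⟨a, ha⟩ := cauchySeq_tendsto_of_complete hcauchy
  refine ⟨a, fun w => le_trans ?_ (hle w)⟩
  have hE : Tendsto (fun n => E (u n)) atTop (𝓝 (E a)) := ((h.continuous hm.le).tendsto a).comp ha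
  have hR : Tendsto (fun n : ℕ => I + m / 8 * (1 / ((n : ℝ) + 1)) ^ 2) atTop (𝓝 I) := by
    simpa using ((tendsto_one_div_add_atTop_nhds_zero_nat.pow 2).const_mul (m / 8)).const_add I
  exact le_of_tendsto_of_tendsto' hE hR fun n => (hu n).le

theorem deriv_eq_zero_of_minimizer (h : QuadPinched E E' m M C) {u : H}
    (hu : ∀ w, E u ≤ E w) (v : H) : E' u v = 0 := by
  have key : ∀ v, 0 ≤ E' u v := fun v =>
    ge_of_tendsto' (h.tendsto_quotient u v) fun n =>
      mul_nonneg (by positivity) (sub_nonneg.2 (hu _))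
  have h1 := key ((-1 : ℝ) • v)
  rw [h.smul] at h1
  linarith [key v]

end QuadPinched

/-! ### Passing from random functionals to their expectation -/

section Superposition

variable {Ω : Type*} [MeasurableSpace Ω] {P : Measure Ω}
  {H : Type*} [NormedAddCommGroup H]

/-- Superposition with a Carathéodory function preserves measurability. -/
lemma aestronglyMeasurable_superposition {e : Ω → H → ℝ}
    (hmeas : ∀ w, Measurable fun ω => e ω w) (hcont : ∀ᵐ ω ∂P, Continuous (e ω))
    {u : Ω → H} (hu : AEStronglyMeasurable u P) :
    AEStronglyMeasurable (fun ω => e ω (u ω)) P := by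
  obtain ⟨g, hg, hug⟩ := hu
  have h1 : AEStronglyMeasurable (fun ω => e ω (g ω)) P := by
    -- For simple g only measurability at each fixed w is needed; continuity in w handles the limit.
    refine aestronglyMeasurable_of_tendsto_ae atTop (f := fun n ω => e ω (hg.approx n ω))
      (fun n => ?_) ?_
    · exact ((hg.approx n).measurable_bind (fun w ω => e ω w) hmeas).aestronglyMeasurable
    · filter_upwards [hcont] with ω hω
      exact (hω.tendsto _).comp (hg.tendsto_approx ω)
  refine h1.congr ?_
  filter_upwards [hug] with ω hω
  rw [hω]

lemma Lp.norm_sq_eq_integral (u : Lp H 2 P) : ‖u‖ ^ 2 = ∫ ω, ‖u ω‖ ^ 2 ∂P := by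
  have := Lp.norm_toLp u (Lp.memLp u)
  rw [Lp.toLp_coeFn, (Lp.memLp u).eLpNorm_eq_integral_rpow_norm (by norm_num) (by norm_num)] at this
  rw [this, ENNReal.toReal_ofReal (by positivity)]
  simp only [ENNReal.toReal_ofNat, Real.rpow_ofNat]
  rw [← Real.rpow_natCast, ← Real.rpow_mul (integral_nonneg fun _ => by positivity)]
  norm_num

lemma Lp.integrable_norm_sq (u : Lp H 2 P) : Integrable (fun ω => ‖u ω‖ ^ 2) P := by
  have := (Lp.memLp u).integrable_norm_pow (p := 2) (by norm_num)
  exact this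

variable [NormedSpace ℝ H] [IsProbabilityMeasure P] {e : Ω → H → ℝ} {e' : Ω → H → H → ℝ}
  {m M C : ℝ}

lemma integrable_deriv_superposition (hmeas : ∀ w, Measurable fun ω => e ω w)
    (h : ∀ᵐ ω ∂P, QuadPinched (e ω) (e' ω) m M C) (hm : 0 ≤ m) (u v : Lp H 2 P) :
    Integrable (fun ω => e' ω (u ω) (v ω)) P := by
  have hcont : ∀ᵐ ω ∂P, Continuous (e ω) := h.mono fun ω hω => hω.continuous hm
  refine Integrable.mono' (g := fun ω => C * (1 + ‖u ω‖ ^ 2 + ‖v ω‖ ^ 2)) ?_ ?_ ?_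
  · exact (((integrable_const 1).add (Lp.integrable_norm_sq u)).add
      (Lp.integrable_norm_sq v)).const_mul C
  -- No measurability of `e'` is assumed: it is inherited from the difference quotients of `e`.
  · refine aestronglyMeasurable_of_tendsto_ae atTop
      (f := fun (n : ℕ) ω => ((n : ℝ) + 1) * (e ω (u ω + ((n : ℝ) + 1)⁻¹ • v ω) - e ω (u ω)))
      (fun n => ?_) ?_
    · refine AEStronglyMeasurable.const_mul (AEStronglyMeasurable.sub ?_ ?_) _
      · exact aestronglyMeasurable_superposition hmeas hcont
          ((Lp.aestronglyMeasurable u).add ((Lp.aestronglyMeasurable v).const_smul _))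
      · exact aestronglyMeasurable_superposition hmeas hcont (Lp.aestronglyMeasurable u)
    · filter_upwards [h] with ω hω
      exact hω.tendsto_quotient _ _
  · filter_upwards [h] with ω hω
    exact hω.bound _ _

lemma integrable_superposition (hmeas : ∀ w, Measurable fun ω => e ω w)
    (h : ∀ᵐ ω ∂P, QuadPinched (e ω) (e' ω) m M C) (hm : 0 ≤ m)
    (h0 : Integrable (fun ω => e ω 0) P) (u : Lp H 2 P) :
    Integrable (fun ω => e ω (u ω)) P := by
  have hcont : ∀ᵐ ω ∂P, Continuous (e ω) := h.mono fun ω hω => hω.continuous hm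
  refine Integrable.mono'
    (g := fun ω => |e ω 0| + C * (1 + ‖u ω‖ ^ 2) + |M| / 2 * ‖u ω‖ ^ 2) ?_ ?_ ?_
  · exact (h0.abs.add (((integrable_const 1).add (Lp.integrable_norm_sq u)).const_mul C)).add
      ((Lp.integrable_norm_sq u).const_mul _)
  · exact aestronglyMeasurable_superposition hmeas hcont (Lp.aestronglyMeasurable u)
  · filter_upwards [h] with ω hω
    have h1 := hω.abs_sub_le hm 0 (u ω)
    have h2 := hω.bound 0 (u ω)
    have h3 := abs_sub_abs_le_abs_sub (e ω (u ω)) (e ω 0)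
    simp only [zero_add, norm_zero, ne_eq, OfNat.ofNat_ne_zero, not_false_eq_true, zero_pow,
      add_zero] at h1 h2
    rw [Real.norm_eq_abs]
    linarith

/-- The expectation of random pinched functionals is pinched on `L²(P; H)`. -/
theorem QuadPinched.superposition (hmeas : ∀ w, Measurable fun ω => e ω w)
    (h : ∀ᵐ ω ∂P, QuadPinched (e ω) (e' ω) m M C) (hm : 0 ≤ m)
    (h0 : Integrable (fun ω => e ω 0) P) :
    QuadPinched (fun u : Lp H 2 P => ∫ ω, e ω (u ω) ∂P)
      (fun u v : Lp H 2 P => ∫ ω, e' ω (u ω) (v ω) ∂P) m M C := by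
  have hi := integrable_superposition hmeas h hm h0
  have hi' := integrable_deriv_superposition hmeas h hm
  have hexp : ∀ (c : ℝ) (u v : Lp H 2 P),
      Integrable (fun ω => e ω (u ω) + e' ω (u ω) (v ω) + c * ‖v ω‖ ^ 2) P ∧
      ∫ ω, (e ω (u ω) + e' ω (u ω) (v ω) + c * ‖v ω‖ ^ 2) ∂P =
        ∫ ω, e ω (u ω) ∂P + ∫ ω, e' ω (u ω) (v ω) ∂P + c * ‖v‖ ^ 2 := by
    intro c u v
    have hc := (Lp.integrable_norm_sq v).const_mul c
    have ha : Integrable (fun ω => e ω (u ω) + e' ω (u ω) (v ω)) P := (hi u).add (hi' u v)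
    refine ⟨ha.add hc, ?_⟩
    rw [integral_add ha hc, integral_add (hi u) (hi' u v),
      integral_const_mul, Lp.norm_sq_eq_integral]
  refine ⟨fun u v t => ?_, fun u v => ?_, fun u v => ?_, fun u v => ?_⟩
  · rw [← integral_const_mul]
    refine integral_congr_ae ?_
    filter_upwards [h, Lp.coeFn_smul t v] with ω hω hv
    rw [hv, Pi.smul_apply, hω.smul]
  · rw [← (hexp (m / 2) u v).2]
    refine integral_mono_ae (hexp (m / 2) u v).1 (hi (u + v)) ?_
    filter_upwards [h, Lp.coeFn_add u v] with ω hω hv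
    rw [hv]
    exact hω.lower _ _
  · rw [← (hexp (M / 2) u v).2]
    refine integral_mono_ae (hi (u + v)) (hexp (M / 2) u v).1 ?_
    filter_upwards [h, Lp.coeFn_add u v] with ω hω hv
    rw [hv]
    exact hω.upper _ _
  · have hu := Lp.integrable_norm_sq u
    have hv := Lp.integrable_norm_sq v
    have ha : Integrable (fun ω => 1 + ‖u ω‖ ^ 2) P := (integrable_const 1).add hu
    have hb : Integrable (fun ω => 1 + ‖u ω‖ ^ 2 + ‖v ω‖ ^ 2) P := ha.add hv
    calc |∫ ω, e' ω (u ω) (v ω) ∂P| ≤ ∫ ω, C * (1 + ‖u ω‖ ^ 2 + ‖v ω‖ ^ 2) ∂P := by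
          rw [← Real.norm_eq_abs]
          refine norm_integral_le_of_norm_le (hb.const_mul C) ?_
          filter_upwards [h] with ω hω
          exact hω.bound _ _
      _ = C * (1 + ‖u‖ ^ 2 + ‖v‖ ^ 2) := by
          rw [integral_const_mul, integral_add ha hv,
            integral_add (integrable_const 1) hu, Lp.norm_sq_eq_integral, Lp.norm_sq_eq_integral]
          simp

end Superposition

/-! ### Convexity on the real line -/

section Pointwise

lemma tangent_le_of_monotone_deriv {h h' : ℝ → ℝ} (hd : ∀ s, HasDerivAt h (h' s) s)
    (hmono : Monotone h') (s t : ℝ) : h s + h' s * t ≤ h (s + t) := by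
  have hderiv : deriv h = h' := funext fun s => (hd s).deriv
  have hc : ConvexOn ℝ Set.univ h :=
    Monotone.convexOn_univ_of_deriv (fun s => (hd s).differentiableAt) (hderiv ▸ hmono)
  rcases lt_trichotomy t 0 with ht | rfl | ht
  · have := hc.slope_le_of_hasDerivAt (Set.mem_univ (s + t)) (Set.mem_univ s) (by linarith) (hd s)
    rw [slope_def_field, div_le_iff₀ (by linarith)] at this
    linarith
  · simp
  · have := hc.le_slope_of_hasDerivAt (Set.mem_univ s) (Set.mem_univ (s + t)) (by linarith) (hd s)
    rw [slope_def_field, le_div_iff₀ (by linarith)] at this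
    linarith

/-- First order expansion of a primitive of a Lipschitz, strongly monotone function. -/
lemma taylor_bounds {G g : ℝ → ℝ} {δ L : ℝ} (hG : ∀ s, HasDerivAt G (g s) s)
    (hg : ∀ s, DifferentiableAt ℝ g s ∧ δ ≤ deriv g s)
    (hL : ∀ s t, |g s - g t| ≤ L * |s - t|) (s t : ℝ) :
    G s + g s * t + δ / 2 * t ^ 2 ≤ G (s + t) ∧ G (s + t) ≤ G s + g s * t + L / 2 * t ^ 2 := by
  have hq : ∀ c s : ℝ, HasDerivAt (fun s => c / 2 * s ^ 2) (c * s) s := fun c s => by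
    refine ((hasDerivAt_pow 2 s).const_mul (c / 2)).congr_deriv ?_
    simp only [Nat.cast_ofNat, Nat.add_one_sub_one, pow_one]
    ring
  constructor
  -- G - δ/2 s² is convex, and its tangent inequality is the claim because the square expands
  -- exactly. The upper bound uses L/2 s² - G likewise.
  · have hm : Monotone fun s => g s - δ * s := by
      have hd : ∀ s, HasDerivAt (fun s => g s - δ * s) (deriv g s - δ) s := fun s => by
        exact ((hg s).1.hasDerivAt.sub ((hasDerivAt_id s).const_mul δ)).congr_deriv (by simp)
      refine monotone_of_deriv_nonneg (fun s => (hd s).differentiableAt) fun s => ?_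
      rw [(hd s).deriv]
      linarith [(hg s).2]
    have := tangent_le_of_monotone_deriv (fun s => (hG s).sub (hq δ s)) hm s t
    simp only [Pi.sub_apply] at this
    linarith
  · have hm : Monotone fun s => L * s - g s := by
      intro a b hab
      have h1 := hL b a
      rw [abs_of_nonneg (sub_nonneg.2 hab)] at h1
      have h2 := le_abs_self (g b - g a)
      simp only
      linarith
    have := tangent_le_of_monotone_deriv (fun s => (hq L s).sub (hG s)) hm s t
    simp only [Pi.sub_apply] at this
    linarith

end Pointwise

variable {d : ℕ} {D : Set (EuclideanSpace ℝ (Fin d))}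

/-! ### Pointwise calculus in `H10` -/

section H10

instance : CompleteSpace (H10 D) :=
  (Submodule.isClosed_topologicalClosure _).completeSpace_coe

lemma H10.measurable_toFun (w : H10 D) : Measurable (H10.toFun w) :=
  (Lp.stronglyMeasurable w.val.fst).measurable

lemma H10.measurable_grad (w : H10 D) : Measurable (H10.grad w) :=
  (Lp.stronglyMeasurable w.val.snd).measurable

lemma H10.integrable_toFun_sq (w : H10 D) :
    Integrable (fun x => H10.toFun w x ^ 2) (volume.restrict D) := by
  simpa [H10.toFun] using Lp.integrable_norm_sq w.val.fst

lemma H10.integrable_grad_sq (w : H10 D) :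
    Integrable (fun x => ‖H10.grad w x‖ ^ 2) (volume.restrict D) :=
  Lp.integrable_norm_sq w.val.snd

lemma H10.norm_sq (w : H10 D) :
    ‖w‖ ^ 2 = ∫ x in D, (‖H10.grad w x‖ ^ 2 + H10.toFun w x ^ 2) := by
  rw [integral_add (H10.integrable_grad_sq w) (H10.integrable_toFun_sq w), Submodule.coe_norm,
    WithLp.prod_norm_sq_eq_of_L2, Lp.norm_sq_eq_integral, Lp.norm_sq_eq_integral, add_comm]
  simp [H10.toFun, H10.grad]

lemma H10.toFun_add (u v : H10 D) :
    ∀ᵐ x ∂volume.restrict D, H10.toFun (u + v) x = H10.toFun u x + H10.toFun v x :=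
  Lp.coeFn_add u.val.fst v.val.fst

lemma H10.grad_add (u v : H10 D) :
    ∀ᵐ x ∂volume.restrict D, H10.grad (u + v) x = H10.grad u x + H10.grad v x :=
  Lp.coeFn_add u.val.snd v.val.snd

lemma H10.toFun_smul (t : ℝ) (v : H10 D) :
    ∀ᵐ x ∂volume.restrict D, H10.toFun (t • v) x = t * H10.toFun v x :=
  Lp.coeFn_smul t v.val.fst

lemma H10.grad_smul (t : ℝ) (v : H10 D) :
    ∀ᵐ x ∂volume.restrict D, H10.grad (t • v) x = t • H10.grad v x :=
  Lp.coeFn_smul t v.val.snd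

lemma H10.toFun_zero : ∀ᵐ x ∂volume.restrict D, H10.toFun (0 : H10 D) x = 0 :=
  Lp.coeFn_zero _ _ _

lemma H10.grad_zero : ∀ᵐ x ∂volume.restrict D, H10.grad (0 : H10 D) x = 0 :=
  Lp.coeFn_zero _ _ _

end H10

/-! ### The energy on `H10` at a fixed parameter -/

/-- The energy density for frozen coefficients. -/
noncomputable def density (k : EuclideanSpace ℝ (Fin d) → ℝ) (G : EuclideanSpace ℝ (Fin d) → ℝ → ℝ) (w : H10 D)
    (x : EuclideanSpace ℝ (Fin d)) : ℝ :=
  1 / 2 * k x * ‖H10.grad w x‖ ^ 2 + G x (H10.toFun w x)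

/-- The integrand of the weak form for frozen coefficients. -/
noncomputable def densityDeriv (k : EuclideanSpace ℝ (Fin d) → ℝ) (g : EuclideanSpace ℝ (Fin d) → ℝ → ℝ)
    (u v : H10 D) (x : EuclideanSpace ℝ (Fin d)) : ℝ :=
  k x * inner ℝ (H10.grad u x) (H10.grad v x) + g x (H10.toFun u x) * H10.toFun v x

/-- Structural assumptions on the coefficients of the energy at a fixed parameter. -/
structure Admissible (D : Set (EuclideanSpace ℝ (Fin d))) (k : EuclideanSpace ℝ (Fin d) → ℝ)
    (g G : EuclideanSpace ℝ (Fin d) → ℝ → ℝ) (κmin κmax fmax Lf δ : ℝ) : Prop where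
  meas_k : Measurable k
  meas_g : Measurable fun p : EuclideanSpace ℝ (Fin d) × ℝ => g p.1 p.2
  meas_G : Measurable fun p : EuclideanSpace ℝ (Fin d) × ℝ => G p.1 p.2
  coercive : ∀ x ∈ D, κmin ≤ k x ∧ k x ≤ κmax
  bounded : ∀ x ∈ D, |g x 0| ≤ fmax
  lipschitz : ∀ x ∈ D, ∀ s t, |g x s - g x t| ≤ Lf * |s - t|
  monotone : ∀ x ∈ D, ∀ s, DifferentiableAt ℝ (g x) s ∧ δ ≤ deriv (g x) s
  hasDerivAt : ∀ x ∈ D, ∀ s, HasDerivAt (G x) (g x s) s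
  integrable : IntegrableOn (fun x => G x 0) D

namespace Admissible

variable {k : EuclideanSpace ℝ (Fin d) → ℝ} {g G : EuclideanSpace ℝ (Fin d) → ℝ → ℝ}
  {κmin κmax fmax Lf δ : ℝ}

lemma abs_k_le (h : Admissible D k g G κmin κmax fmax Lf δ) (hκ : 0 < κmin) {x}
    (hx : x ∈ D) : |k x| ≤ |κmax| := by
  have := h.coercive x hx
  rw [abs_of_nonneg (by linarith)]
  exact this.2.trans (le_abs_self _)

lemma abs_g_le (h : Admissible D k g G κmin κmax fmax Lf δ) {x} (hx : x ∈ D) (s : ℝ) :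
    |g x s| ≤ |fmax| + |Lf| * |s| := by
  have h1 := h.bounded x hx
  have h2 := h.lipschitz x hx s 0
  have h3 := abs_sub_abs_le_abs_sub (g x s) (g x 0)
  rw [sub_zero] at h2
  have h4 : Lf * |s| ≤ |Lf| * |s| := by gcongr; exact le_abs_self _
  linarith [le_abs_self fmax]

/-- Linear growth of g in s and Young's inequality give at most quadratic growth, which serves both
integrability and the `bound` field of `QuadPinched`. -/
lemma abs_densityDeriv_le (h : Admissible D k g G κmin κmax fmax Lf δ) (hκ : 0 < κmin)
    (u v : H10 D) {x} (hx : x ∈ D) :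
    |densityDeriv k g u v x| ≤ (|κmax| + |fmax| + |Lf|) *
      (1 + (‖H10.grad u x‖ ^ 2 + H10.toFun u x ^ 2) +
        (‖H10.grad v x‖ ^ 2 + H10.toFun v x ^ 2)) := by
  unfold densityDeriv
  set a := H10.grad u x
  set b := H10.grad v x
  set s := H10.toFun u x
  set t := H10.toFun v x
  have h1 : |k x * inner ℝ a b| ≤ |κmax| * (‖a‖ ^ 2 + ‖b‖ ^ 2) := by
    rw [abs_mul]
    have hi : |inner ℝ a b| ≤ ‖a‖ ^ 2 + ‖b‖ ^ 2 := by
      nlinarith [abs_real_inner_le_norm a b, sq_nonneg (‖a‖ - ‖b‖), sq_nonneg ‖a‖, sq_nonneg ‖b‖]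
    exact mul_le_mul (h.abs_k_le hκ hx) hi (abs_nonneg _) (abs_nonneg _)
  have h2 : |g x s * t| ≤ |fmax| * (1 + t ^ 2) + |Lf| * (s ^ 2 + t ^ 2) := by
    rw [abs_mul]
    have e1 : |t| ≤ 1 + t ^ 2 := by
      rw [← sq_abs]
      nlinarith [sq_nonneg (|t| - 1), sq_nonneg (|t|)]
    have e2 : |s| * |t| ≤ s ^ 2 + t ^ 2 := by
      rw [← sq_abs s, ← sq_abs t]
      nlinarith [sq_nonneg (|s| - |t|), sq_nonneg (|s|), sq_nonneg (|t|)]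
    calc |g x s| * |t| ≤ (|fmax| + |Lf| * |s|) * |t| := by
          gcongr; exact h.abs_g_le hx s
      _ = |fmax| * |t| + |Lf| * (|s| * |t|) := by ring
      _ ≤ _ := by gcongr
  have h3 := abs_add_le (k x * inner ℝ a b) (g x s * t)
  have p1 : |κmax| * (‖a‖ ^ 2 + ‖b‖ ^ 2) ≤
      |κmax| * (1 + (‖a‖ ^ 2 + s ^ 2) + (‖b‖ ^ 2 + t ^ 2)) := by
    refine mul_le_mul_of_nonneg_left ?_ (abs_nonneg _)
    nlinarith [sq_nonneg s, sq_nonneg t]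
  have p2 : |fmax| * (1 + t ^ 2) ≤
      |fmax| * (1 + (‖a‖ ^ 2 + s ^ 2) + (‖b‖ ^ 2 + t ^ 2)) := by
    refine mul_le_mul_of_nonneg_left ?_ (abs_nonneg _)
    nlinarith [sq_nonneg s, sq_nonneg ‖a‖, sq_nonneg ‖b‖]
  have p3 : |Lf| * (s ^ 2 + t ^ 2) ≤
      |Lf| * (1 + (‖a‖ ^ 2 + s ^ 2) + (‖b‖ ^ 2 + t ^ 2)) := by
    refine mul_le_mul_of_nonneg_left ?_ (abs_nonneg _)
    nlinarith [sq_nonneg ‖a‖, sq_nonneg ‖b‖]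
  linarith

/-- The gradient term expands exactly, with remainder ½ k |∇v|²; the G term obeys `taylor_bounds`.
Additivity at x is assumed because representatives add only almost everywhere. -/
lemma density_taylor (h : Admissible D k g G κmin κmax fmax Lf δ) (u v : H10 D) {x} (hx : x ∈ D)
    (hs : H10.toFun (u + v) x = H10.toFun u x + H10.toFun v x)
    (hg : H10.grad (u + v) x = H10.grad u x + H10.grad v x) :
    density k G u x + densityDeriv k g u v x +
        min κmin δ / 2 * (‖H10.grad v x‖ ^ 2 + H10.toFun v x ^ 2) ≤ density k G (u + v) x ∧
      density k G (u + v) x ≤ density k G u x + densityDeriv k g u v x +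
        max κmax Lf / 2 * (‖H10.grad v x‖ ^ 2 + H10.toFun v x ^ 2) := by
  unfold density densityDeriv
  rw [hs, hg, norm_add_sq_real]
  set a := H10.grad u x
  set b := H10.grad v x
  set s := H10.toFun u x
  set t := H10.toFun v x
  obtain ⟨h1, h2⟩ := taylor_bounds (h.hasDerivAt x hx) (h.monotone x hx) (h.lipschitz x hx) s t
  obtain ⟨k1, k2⟩ := h.coercive x hx
  have e1 : min κmin δ * ‖b‖ ^ 2 ≤ k x * ‖b‖ ^ 2 := by
    gcongr; exact (min_le_left _ _).trans k1
  have e2 : min κmin δ * t ^ 2 ≤ δ * t ^ 2 := by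
    gcongr; exact min_le_right _ _
  have e3 : k x * ‖b‖ ^ 2 ≤ max κmax Lf * ‖b‖ ^ 2 := by
    gcongr; exact k2.trans (le_max_left _ _)
  have e4 : Lf * t ^ 2 ≤ max κmax Lf * t ^ 2 := by
    gcongr; exact le_max_right _ _
  constructor <;> linarith

lemma integrable_densityDeriv (h : Admissible D k g G κmin κmax fmax Lf δ) (hκ : 0 < κmin)
    (hD : MeasurableSet D) (hvol : volume D ≠ ⊤) (u v : H10 D) :
    Integrable (densityDeriv k g u v) (volume.restrict D) := by
  have hfin : IsFiniteMeasure (volume.restrict D) := ⟨by simpa using hvol.lt_top⟩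
  refine Integrable.mono' ((((integrable_const 1).add
    ((H10.integrable_grad_sq u).add (H10.integrable_toFun_sq u))).add
    ((H10.integrable_grad_sq v).add (H10.integrable_toFun_sq v))).const_mul
      (|κmax| + |fmax| + |Lf|)) ?_ ?_
  · have := H10.measurable_grad u
    have := H10.measurable_grad v
    have := H10.measurable_toFun v
    have hg := h.meas_g.comp (measurable_id.prodMk (H10.measurable_toFun u))
    exact ((h.meas_k.mul (by fun_prop)).add (hg.mul (by fun_prop))).aestronglyMeasurable
  · filter_upwards [ae_restrict_mem hD] with x hx
    exact h.abs_densityDeriv_le hκ u v hx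

lemma integrable_density_zero (h : Admissible D k g G κmin κmax fmax Lf δ) :
    Integrable (density k G (0 : H10 D)) (volume.restrict D) := by
  refine h.integrable.congr ?_
  filter_upwards [H10.toFun_zero (D := D), H10.grad_zero (D := D)] with x h1 h2
  simp [density, h1, h2]

lemma integrable_density (h : Admissible D k g G κmin κmax fmax Lf δ) (hκ : 0 < κmin)
    (hD : MeasurableSet D) (hvol : volume D ≠ ⊤) (w : H10 D) :
    Integrable (density k G w) (volume.restrict D) := by
  -- The expansion around 0 traps the density between two integrable functions.
  have hb := h.integrable_density_zero.add (h.integrable_densityDeriv hκ hD hvol 0 w)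
  have hq := (H10.integrable_grad_sq w).add (H10.integrable_toFun_sq w)
  refine integrable_of_le_of_le ?_ ?_ ?_ (hb.add (hq.const_mul (min κmin δ / 2)))
    (hb.add (hq.const_mul (max κmax Lf / 2)))
  · have := H10.measurable_grad w
    have := h.meas_k
    have hG := h.meas_G.comp (measurable_id.prodMk (H10.measurable_toFun w))
    exact (Measurable.add (by fun_prop) hG).aestronglyMeasurable
  all_goals
    filter_upwards [ae_restrict_mem hD, H10.toFun_add 0 w, H10.grad_add 0 w] with x hx h1 h2
    have := h.density_taylor 0 w hx h1 h2
    rw [zero_add] at this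
  · exact this.1
  · exact this.2

/-- The energy with frozen coefficients is pinched between quadratic functionals on `H¹₀(D)`. -/
theorem quadPinched (h : Admissible D k g G κmin κmax fmax Lf δ) (hκ : 0 < κmin)
    (hD : MeasurableSet D) (hvol : volume D ≠ ⊤) :
    QuadPinched (fun w : H10 D => ∫ x in D, density k G w x)
      (fun u v : H10 D => ∫ x in D, densityDeriv k g u v x) (min κmin δ) (max κmax Lf)
      ((|κmax| + |fmax| + |Lf|) * (volume.real D + 1)) := by
  have hfin : IsFiniteMeasure (volume.restrict D) := ⟨by simpa using hvol.lt_top⟩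
  have hi := h.integrable_density hκ hD hvol
  have hi' := h.integrable_densityDeriv hκ hD hvol
  have hq : ∀ w : H10 D, Integrable (fun x => ‖H10.grad w x‖ ^ 2 + H10.toFun w x ^ 2)
      (volume.restrict D) := fun w => (H10.integrable_grad_sq w).add (H10.integrable_toFun_sq w)
  have hexp : ∀ (c : ℝ) (u v : H10 D),
      Integrable (fun x => density k G u x + densityDeriv k g u v x +
        c * (‖H10.grad v x‖ ^ 2 + H10.toFun v x ^ 2)) (volume.restrict D) ∧
      ∫ x in D, (density k G u x + densityDeriv k g u v x +
        c * (‖H10.grad v x‖ ^ 2 + H10.toFun v x ^ 2)) =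
        (∫ x in D, density k G u x) + (∫ x in D, densityDeriv k g u v x) + c * ‖v‖ ^ 2 := by
    intro c u v
    have ha : Integrable (fun x => density k G u x + densityDeriv k g u v x)
      (volume.restrict D) := (hi u).add (hi' u v)
    have hc := (hq v).const_mul c
    refine ⟨ha.add hc, ?_⟩
    rw [integral_add ha hc, integral_add (hi u) (hi' u v), integral_const_mul, H10.norm_sq]
  refine ⟨fun u v t => ?_, fun u v => ?_, fun u v => ?_, fun u v => ?_⟩
  · rw [← integral_const_mul]
    refine integral_congr_ae ?_
    filter_upwards [H10.toFun_smul t v, H10.grad_smul t v] with x h1 h2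
    simp only [densityDeriv, h1, h2, real_inner_smul_right]
    ring
  · rw [← (hexp _ u v).2]
    refine integral_mono_ae (hexp _ u v).1 (hi (u + v)) ?_
    filter_upwards [ae_restrict_mem hD, H10.toFun_add u v, H10.grad_add u v] with x hx h1 h2
    exact (h.density_taylor u v hx h1 h2).1
  · rw [← (hexp _ u v).2]
    refine integral_mono_ae (hi (u + v)) (hexp _ u v).1 ?_
    filter_upwards [ae_restrict_mem hD, H10.toFun_add u v, H10.grad_add u v] with x hx h1 h2
    exact (h.density_taylor u v hx h1 h2).2
  · set B := |κmax| + |fmax| + |Lf| with hB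
    have hB0 : 0 ≤ B := by positivity
    have ha : Integrable (fun x => 1 + (‖H10.grad u x‖ ^ 2 + H10.toFun u x ^ 2))
      (volume.restrict D) := (integrable_const 1).add (hq u)
    calc |∫ x in D, densityDeriv k g u v x| ≤
        ∫ x in D, B * (1 + (‖H10.grad u x‖ ^ 2 + H10.toFun u x ^ 2) +
          (‖H10.grad v x‖ ^ 2 + H10.toFun v x ^ 2)) := by
          rw [← Real.norm_eq_abs]
          refine norm_integral_le_of_norm_le ((ha.add (hq v)).const_mul B) ?_
          filter_upwards [ae_restrict_mem hD] with x hx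
          exact h.abs_densityDeriv_le hκ u v hx
      _ = B * (volume.real D + ‖u‖ ^ 2 + ‖v‖ ^ 2) := by
          rw [integral_const_mul, integral_add ha (hq v), integral_add (integrable_const 1) (hq u),
            H10.norm_sq, H10.norm_sq]
          simp
      -- The factor |D| + 1 dominates both |D| and the unit coefficients of the squared norms.
      _ ≤ B * (volume.real D + 1) * (1 + ‖u‖ ^ 2 + ‖v‖ ^ 2) := by
          rw [mul_assoc]
          gcongr
          have : 0 ≤ volume.real D := measureReal_nonneg
          nlinarith [mul_nonneg this (sq_nonneg ‖u‖), mul_nonneg this (sq_nonneg ‖v‖)]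

end Admissible

end StochElliptic

/-! ### The stochastic problem -/

theorem theorem1 {d K : ℕ} {Ω : Type*} [MeasurableSpace Ω]
    (P : Measure Ω) [IsProbabilityMeasure P]
    (D : Set (EuclideanSpace ℝ (Fin d))) (hD_open : IsOpen D) (hD_bdd : Bornology.IsBounded D)
    (Y : Ω → Fin K → ℝ) (hY : Measurable Y)
    (κ : EuclideanSpace ℝ (Fin d) → (Fin K → ℝ) → ℝ)
    (f F : EuclideanSpace ℝ (Fin d) → ℝ → (Fin K → ℝ) → ℝ)
    (hκ_meas : Measurable fun p : EuclideanSpace ℝ (Fin d) × (Fin K → ℝ) => κ p.1 p.2)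
    (hf_meas : Measurable fun p : EuclideanSpace ℝ (Fin d) × ℝ × (Fin K → ℝ) =>
      f p.1 p.2.1 p.2.2)
    (hF_meas : Measurable fun p : EuclideanSpace ℝ (Fin d) × ℝ × (Fin K → ℝ) =>
      F p.1 p.2.1 p.2.2)
    -- `κ` is uniformly bounded and uniformly coercive
    (κmin κmax : ℝ) (hκmin : 0 < κmin)
    (hκ : ∀ᵐ ω ∂P, ∀ x ∈ closure D, κmin ≤ κ x (Y ω) ∧ κ x (Y ω) ≤ κmax)
    -- `f(·, 0, Y)` is uniformly bounded, `f` is uniformly Lipschitz in `u`, and `∂_u f ≥ δ > 0`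
    (fmax : ℝ) (hf_bdd : ∀ᵐ ω ∂P, ∀ x ∈ closure D, |f x 0 (Y ω)| ≤ fmax)
    (Lf : ℝ) (hf_lip : ∀ᵐ ω ∂P, ∀ x ∈ closure D, ∀ u₁ u₂ : ℝ,
      |f x u₁ (Y ω) - f x u₂ (Y ω)| ≤ Lf * |u₁ - u₂|)
    (δ : ℝ) (hδ : 0 < δ)
    (hf_deriv : ∀ᵐ ω ∂P, ∀ x ∈ closure D, ∀ u : ℝ,
      DifferentiableAt ℝ (fun s => f x s (Y ω)) u ∧ δ ≤ deriv (fun s => f x s (Y ω)) u)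
    -- `∂_u F = f`, `F` is uniformly bounded from below, and the zero field has finite energy
    (hF_deriv : ∀ᵐ ω ∂P, ∀ x ∈ closure D, ∀ u : ℝ,
      HasDerivAt (fun s => F x s (Y ω)) (f x u (Y ω)) u)
    (Fmin : ℝ) (hF_below : ∀ᵐ ω ∂P, ∀ x ∈ closure D, ∀ u : ℝ, Fmin ≤ F x u (Y ω))
    (hF_zero : Integrable (fun p : EuclideanSpace ℝ (Fin d) × Ω => F p.1 0 (Y p.2))
      ((volume.restrict D).prod P)) :
    -- the energy is well defined and finite on the whole space
    (∀ u : StochElliptic.VS D P,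
      StochElliptic.ExpIntegrable D P (StochElliptic.energyDensity κ F Y u)) ∧
    -- a minimizer exists
    (∃ u : StochElliptic.VS D P, ∀ w : StochElliptic.VS D P,
      StochElliptic.energy κ F Y u ≤ StochElliptic.energy κ F Y w) ∧
    -- every minimizer satisfies the weak form
    (∀ u : StochElliptic.VS D P,
      (∀ w : StochElliptic.VS D P, StochElliptic.energy κ F Y u ≤ StochElliptic.energy κ F Y w) →
      ∀ v : StochElliptic.VS D P,
        StochElliptic.ExpIntegrable D P (StochElliptic.weakDensity κ f Y u v) ∧
        StochElliptic.expIntegral D P (StochElliptic.weakDensity κ f Y u v) = 0) := by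
  have hDm := hD_open.measurableSet
  have hvol : volume D ≠ ⊤ := hD_bdd.measure_lt_top.ne
  have hzero : ∀ᵐ ω ∂P, IntegrableOn (fun x => F x 0 (Y ω)) D := hF_zero.prod_left_ae
  have hadm : ∀ᵐ ω ∂P, StochElliptic.Admissible D (fun x => κ x (Y ω)) (fun x s => f x s (Y ω))
      (fun x s => F x s (Y ω)) κmin κmax fmax Lf δ := by
    filter_upwards [hκ, hf_bdd, hf_lip, hf_deriv, hF_deriv, hzero] with ω h1 h2 h3 h4 h5 h6
    exact
      { meas_k := hκ_meas.comp (measurable_id.prodMk measurable_const)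
        meas_g := hf_meas.comp (measurable_fst.prodMk (measurable_snd.prodMk measurable_const))
        meas_G := hF_meas.comp (measurable_fst.prodMk (measurable_snd.prodMk measurable_const))
        coercive := fun x hx => h1 x (subset_closure hx)
        bounded := fun x hx => h2 x (subset_closure hx)
        lipschitz := fun x hx => h3 x (subset_closure hx)
        monotone := fun x hx => h4 x (subset_closure hx)
        hasDerivAt := fun x hx => h5 x (subset_closure hx)
        integrable := h6 }
  have hpinched := hadm.mono fun ω h => h.quadPinched hκmin hDm hvol
  have hm : 0 < min κmin δ := lt_min hκmin hδ
  have hmeas : ∀ w : StochElliptic.H10 D, Measurable fun ω =>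
      ∫ x in D, StochElliptic.density (fun x => κ x (Y ω)) (fun x s => F x s (Y ω)) w x := by
    intro w
    have hw := StochElliptic.H10.measurable_toFun w
    have hg := StochElliptic.H10.measurable_grad w
    have hκ' : Measurable fun p : Ω × EuclideanSpace ℝ (Fin d) => κ p.2 (Y p.1) :=
      hκ_meas.comp (measurable_snd.prodMk (hY.comp measurable_fst))
    have hF' : Measurable fun p : Ω × EuclideanSpace ℝ (Fin d) =>
        F p.2 (StochElliptic.H10.toFun w p.2) (Y p.1) :=
      hF_meas.comp (measurable_snd.prodMk ((hw.comp measurable_snd).prodMk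
        (hY.comp measurable_fst)))
    have : Measurable fun p : Ω × EuclideanSpace ℝ (Fin d) =>
        StochElliptic.density (fun x => κ x (Y p.1)) (fun x s => F x s (Y p.1)) w p.2 := by
      unfold StochElliptic.density
      fun_prop
    exact this.stronglyMeasurable.integral_prod_right'.measurable
  have hint_zero : Integrable (fun ω => ∫ x in D,
      StochElliptic.density (fun x => κ x (Y ω)) (fun x s => F x s (Y ω)) (0 : StochElliptic.H10 D) x)
      P := by
    refine hF_zero.integral_prod_right.congr (Filter.Eventually.of_forall fun ω => ?_)
    refine integral_congr_ae ?_
    filter_upwards [StochElliptic.H10.toFun_zero (D := D), StochElliptic.H10.grad_zero (D := D)]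
      with x h1 h2
    simp [StochElliptic.density, h1, h2]
  have hE := StochElliptic.QuadPinched.superposition hmeas hpinched hm.le hint_zero
  -- `energy` and the integrated `weakDensity` unfold definitionally to the functional and
  -- derivative in `hE`.
  refine ⟨fun u => ⟨?_, ?_⟩, hE.exists_minimizer hm, fun u hu v => ⟨⟨?_, ?_⟩, ?_⟩⟩
  · exact hadm.mono fun ω h => h.integrable_density hκmin hDm hvol (u ω)
  · exact StochElliptic.integrable_superposition hmeas hpinched hm.le hint_zero u
  · exact hadm.mono fun ω h => h.integrable_densityDeriv hκmin hDm hvol (u ω) (v ω)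
  · exact StochElliptic.integrable_deriv_superposition hmeas hpinched hm.le u v
  · exact hE.deriv_eq_zero_of_minimizer hu v
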